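/- Let $\mathcal H$ be a complex Hilbert space. For a bounded linear operator $T$ on $\mathcal H$ let $W(T)=\{\langle Tx,x\rangle : x\in\mathcal H,\ \|x\|=1\}$ be its numerical range and $w(T)=\sup\{|\mu| : \mu\in W(T)\}$ its numerical radius. Let $\alpha\in(0,\pi/2]$, and let $S(\alpha)=\{a+ib : a,b\in\mathbb R,\ |b|\le a\tan\alpha\}$ if $\alpha<\pi/2$, and $S(\pi/2)=\{a+ib : a,b\in\mathbb R,\ a\ge 0\}$. Then the following hold. 1. If $T$ is a bounded linear operator on $\mathcal H$ with $W(T)\subseteq S(\alpha)$, then $\|T\|\le w(T)\sqrt{1+\sin^2\alpha}$. 2. With $s=\sin^2\alpha$, the $2\times 2$ matrix $$T_1=\frac{1}{1+2s}\begin{pmatrix}\sqrt{1+s-s^2}+i\sqrt{s+s^2} & 2s\\ 0 & \sqrt{1+s-s^2}-i\sqrt{s+s^2}\end{pmatrix}$$ is nonzero and satisfies $W(T_1)\subseteq S(\alpha)$ and $\|T_1\|/w(T_1)=\sqrt{1+\sin^2\alpha}$. 3. Let $A$ be any nonzero complex $2\times 2$ matrix with $W(A)\subseteq S(\alpha)$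 and $\|A\|/w(A)=\sqrt{1+\sin^2\alpha}$ (for instance $A=T_1$), and let $V\subseteq\mathcal H$ be a two-dimensional subspace, identified with $\mathbb C^2$ by an orthonormal basis. Then the operator $T=A\oplus 0$ on $\mathcal H=V\oplus V^\perp$ is nonzero and satisfies $W(T)\subseteq S(\alpha)$ and $\|T\|/w(T)=\sqrt{1+\sin^2\alpha}$. 4. If $\dim\mathcal H>1$, then such subspaces $V$ exist, and the optimal ratio $$\tau(\alpha)=\sup\{\|T\|/w(T) : T \text{ a bounded linear operator on } \mathcal H,\ T\ne 0,\ W(T)\subseteq S(\alpha)\}$$ is attained and equals $\sqrt{1+\sin^2\alpha}$. -/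

import Mathlib

noncomputable section

namespace SectorialOperator

/-- The numerical range `W(T) = {⟨Tx, x⟩ : ‖x‖ = 1}`. Mathlib's inner product is linear in its
second argument, so `⟨Tx, x⟩` (linear in `Tx`) is `inner ℂ x (T x)`. -/
def numericalRange {H : Type*} [NormedAddCommGroup H] [InnerProductSpace ℂ H]
    (T : H →L[ℂ] H) : Set ℂ :=
  {z | ∃ x : H, ‖x‖ = 1 ∧ z = inner ℂ x (T x)}

/-- The numerical radius `w(T) = sup {|μ| : μ ∈ W(T)}`. -/
def numericalRadius {H : Type*} [NormedAddCommGroup H] [InnerProductSpace ℂ H]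
    (T : H →L[ℂ] H) : ℝ :=
  sSup ((fun z : ℂ => ‖z‖) '' numericalRange T)

/-- The sector `S(α) = {a + ib : |b| ≤ a tan α}`, written without division so that it is the
closed right half-plane at `α = π / 2` (where `tan α` is infinite); see the two lemmas below. -/
def sector (α : ℝ) : Set ℂ :=
  {z | 0 ≤ z.re ∧ |z.im| * Real.cos α ≤ z.re * Real.sin α}

theorem mem_sector_iff_tan {α : ℝ} (h0 : 0 < α) (h1 : α < Real.pi / 2) (z : ℂ) :
    z ∈ sector α ↔ |z.im| ≤ z.re * Real.tan α := by
  have hc : 0 < Real.cos α := Real.cos_pos_of_mem_Ioo ⟨by linarith [Real.pi_pos], h1⟩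
  have ht : 0 < Real.tan α := Real.tan_pos_of_pos_of_lt_pi_div_two h0 h1
  have key : |z.im| * Real.cos α ≤ z.re * Real.sin α ↔ |z.im| ≤ z.re * Real.tan α := by
    rw [Real.tan_eq_sin_div_cos, ← mul_div_assoc, le_div_iff₀ hc]
  constructor
  · rintro ⟨-, h⟩
    exact key.1 h
  · intro h
    refine ⟨?_, key.2 h⟩
    exact nonneg_of_mul_nonneg_left (le_trans (abs_nonneg _) h) ht

theorem mem_sector_pi_div_two_iff (z : ℂ) : z ∈ sector (Real.pi / 2) ↔ 0 ≤ z.re := by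
  simp [sector]

/-- The operator on `ℂ²` (with its Euclidean norm) given by a `2 × 2` matrix. -/
abbrev matOp (A : Matrix (Fin 2) (Fin 2) ℂ) :
    EuclideanSpace ℂ (Fin 2) →L[ℂ] EuclideanSpace ℂ (Fin 2) :=
  Matrix.toEuclideanCLM (n := Fin 2) (𝕜 := ℂ) A

/-- The matrix
`(1 + 2s)⁻¹ [[√(1 + s - s²) + i √(s + s²), 2s], [0, √(1 + s - s²) - i √(s + s²)]]`
with `s = sin² α`. -/
def extremalMatrix (α : ℝ) : Matrix (Fin 2) (Fin 2) ℂ :=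
  let s : ℝ := Real.sin α ^ 2
  let p : ℝ := Real.sqrt (1 + s - s ^ 2)
  let q : ℝ := Real.sqrt (s + s ^ 2)
  (((1 + 2 * s)⁻¹ : ℝ) : ℂ) •
    !![(p : ℂ) + Complex.I * (q : ℂ), ((2 * s : ℝ) : ℂ);
       0, (p : ℂ) - Complex.I * (q : ℂ)]

/-- The operator `A ⊕ 0` on `H = V ⊕ Vᗮ`, where `V` is the two-dimensional range of the linear
isometry `J : ℂ² → H`, through which `A` is regarded as an operator on `V`. -/
def sumZero {H : Type*} [NormedAddCommGroup H] [InnerProductSpace ℂ H] [CompleteSpace H]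
    (J : EuclideanSpace ℂ (Fin 2) →ₗᵢ[ℂ] H) (A : Matrix (Fin 2) (Fin 2) ℂ) : H →L[ℂ] H :=
  J.toContinuousLinearMap ∘L matOp A ∘L
    ContinuousLinearMap.adjoint J.toContinuousLinearMap

theorem sumZero_apply_isometry {H : Type*} [NormedAddCommGroup H] [InnerProductSpace ℂ H]
    [CompleteSpace H] (J : EuclideanSpace ℂ (Fin 2) →ₗᵢ[ℂ] H) (A : Matrix (Fin 2) (Fin 2) ℂ)
    (v : EuclideanSpace ℂ (Fin 2)) : sumZero J A (J v) = J (matOp A v) := by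
  have h : ContinuousLinearMap.adjoint J.toContinuousLinearMap (J v) = v := by
    refine ext_inner_left ℂ fun u => ?_
    rw [ContinuousLinearMap.adjoint_inner_right]
    exact J.inner_map_map u v
  simp only [sumZero, ContinuousLinearMap.comp_apply, h]
  rfl

theorem sumZero_apply_orthogonal {H : Type*} [NormedAddCommGroup H] [InnerProductSpace ℂ H]
    [CompleteSpace H] (J : EuclideanSpace ℂ (Fin 2) →ₗᵢ[ℂ] H) (A : Matrix (Fin 2) (Fin 2) ℂ)
    (y : H) (hy : ∀ v, inner ℂ (J v) y = 0) : sumZero J A y = 0 := by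
  have h : ContinuousLinearMap.adjoint J.toContinuousLinearMap y = 0 := by
    refine ext_inner_left ℂ fun u => ?_
    rw [ContinuousLinearMap.adjoint_inner_right, inner_zero_right]
    exact hy u
  simp only [sumZero, ContinuousLinearMap.comp_apply, h, map_zero]

/-- The set of all ratios `‖T‖ / w(T)`, for nonzero `T` on `H` with `W(T) ⊆ S(α)`. -/
def ratioSet (H : Type*) [NormedAddCommGroup H] [InnerProductSpace ℂ H] (α : ℝ) : Set ℝ :=
  {r | ∃ T : H →L[ℂ] H, T ≠ 0 ∧ numericalRange T ⊆ sector α ∧ r = ‖T‖ / numericalRadius T}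

/-- The optimal ratio `τ(α)`, the supremum of the ratios `‖T‖ / w(T)`. -/
def tau (H : Type*) [NormedAddCommGroup H] [InnerProductSpace ℂ H] (α : ℝ) : ℝ :=
  sSup (ratioSet H α)

end SectorialOperator

end

open SectorialOperator

/-!
Write `f u = ⟨T u, u⟩` and `s = sin² α`. The inequality `‖T‖ ≤ w(T) √(1 + s)` rests on a weighted
polarization identity: with `p = √(1 + s - s²)` and the unimodular number `ζ` given by
`p ζ = 1 + i sin α cos α`,
`4 ⟨T x, y⟩ = (p + i s) f (x + i y) + (p - i s) f (x - i y)`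
`  - (p / sin α) ((sin α + i cos α) f (x - ζ y) + (sin α - i cos α) f (x - ζ̄ y))`.
The real part of the bracket is nonnegative because `f` takes its values in the sector, and
`|p ± i s| = √(1 + s)`, so the parallelogram law gives
`4 Re ⟨T x, y⟩ ≤ 2 w(T) √(1 + s) (‖x‖² + ‖y‖²)`; the bound follows with `y` a multiple of `T x`
of the same length as `x`.  This is `re_inner_le_of_sector` and `opNorm_le_of_sector`.

For the extremal matrix `T₁`, with `q = √(s + s²)`, the quadratic form is expressed in the coordinates
`|a|² - |b|²`, `2 Re (ā b)`, `2 Im (ā b)` of the vector `(a, b)`, whose squares add up to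
`(|a|² + |b|²)²`; Cauchy–Schwarz then gives both the inclusion in the sector and
`w(T₁) ≤ 1 / √(1 + s)`, while `T₁` maps `(p - i q, 1 + 2 s)` to `(1 + 2 s, p - i q)`, so `‖T₁‖ ≥ 1`.
The quadratic form of `A ⊕ 0` at `x` is that of `A` at the coordinates of the projection of `x`
to `V`, so norm, numerical radius and inclusion in the sector are unchanged.
-/

namespace SectorialOperator

open Complex

/-! ### The numerical radius -/

section

variable {H : Type*} [NormedAddCommGroup H] [InnerProductSpace ℂ H]

theorem bddAbove_norm_numericalRange (T : H →L[ℂ] H) :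
    BddAbove ((fun z : ℂ => ‖z‖) '' numericalRange T) := by
  refine ⟨‖T‖, ?_⟩
  rintro _ ⟨_, ⟨x, hx, rfl⟩, rfl⟩
  calc ‖inner ℂ x (T x)‖ ≤ ‖x‖ * ‖T x‖ := norm_inner_le_norm _ _
    _ ≤ ‖x‖ * (‖T‖ * ‖x‖) := by gcongr; exact T.le_opNorm x
    _ = ‖T‖ := by simp [hx]

theorem numericalRadius_nonneg (T : H →L[ℂ] H) : 0 ≤ numericalRadius T := by
  refine Real.sSup_nonneg ?_
  rintro _ ⟨z, -, rfl⟩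
  exact norm_nonneg z

theorem inner_smul_map_smul (T : H →L[ℂ] H) (r : ℝ) (u : H) :
    inner ℂ ((r : ℂ) • u) (T ((r : ℂ) • u)) = ((r ^ 2 : ℝ) : ℂ) * inner ℂ u (T u) := by
  rw [map_smul, inner_smul_left, inner_smul_right, conj_ofReal, ← mul_assoc]
  push_cast
  ring

theorem inner_map_eq_norm_sq_mul (T : H →L[ℂ] H) {u : H} (hu : u ≠ 0) :
    ∃ z ∈ numericalRange T, inner ℂ u (T u) = ((‖u‖ ^ 2 : ℝ) : ℂ) * z := by
  have hn : ‖u‖ ≠ 0 := norm_ne_zero_iff.2 hu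
  refine ⟨_, ⟨((‖u‖⁻¹ : ℝ) : ℂ) • u, ?_, rfl⟩, ?_⟩
  · rw [norm_smul, norm_real, norm_inv, norm_norm, inv_mul_cancel₀ hn]
  · rw [inner_smul_map_smul, ← mul_assoc, ← ofReal_mul, ← mul_pow, mul_inv_cancel₀ hn]
    simp

theorem norm_inner_map_le (T : H →L[ℂ] H) (u : H) :
    ‖inner ℂ u (T u)‖ ≤ numericalRadius T * ‖u‖ ^ 2 := by
  rcases eq_or_ne u 0 with rfl | hu
  · simp
  obtain ⟨z, hz, h⟩ := inner_map_eq_norm_sq_mul T hu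
  rw [h, norm_mul, norm_real, Real.norm_of_nonneg (sq_nonneg _), mul_comm]
  gcongr
  exact le_csSup (bddAbove_norm_numericalRange T) ⟨z, hz, rfl⟩

theorem numericalRadius_le (T : H →L[ℂ] H) {c : ℝ} (hc : 0 ≤ c)
    (h : ∀ u : H, ‖inner ℂ u (T u)‖ ≤ c * ‖u‖ ^ 2) : numericalRadius T ≤ c := by
  refine Real.sSup_le ?_ hc
  rintro _ ⟨_, ⟨x, hx, rfl⟩, rfl⟩
  simpa [hx] using h x

theorem ofReal_mul_mem_sector {α r : ℝ} {z : ℂ} (hr : 0 ≤ r) (hz : z ∈ sector α) :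
    (r : ℂ) * z ∈ sector α := by
  obtain ⟨h1, h2⟩ := hz
  refine ⟨?_, ?_⟩
  · rw [re_ofReal_mul]
    positivity
  · rw [re_ofReal_mul, im_ofReal_mul, abs_mul, abs_of_nonneg hr, mul_assoc, mul_assoc]
    gcongr

theorem inner_map_mem_sector {α : ℝ} {T : H →L[ℂ] H} (hT : numericalRange T ⊆ sector α)
    (u : H) : inner ℂ u (T u) ∈ sector α := by
  rcases eq_or_ne u 0 with rfl | hu
  · simp [sector]
  obtain ⟨z, hz, h⟩ := inner_map_eq_norm_sq_mul T hu
  rw [h]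
  exact ofReal_mul_mem_sector (sq_nonneg _) (hT hz)

/-! ### The inequality for sectorial operators -/

theorem inner_add_smul_map (T : H →L[ℂ] H) (x y : H) (ζ : ℂ) :
    inner ℂ (x + ζ • y) (T (x + ζ • y)) =
      inner ℂ x (T x) + (‖ζ‖ ^ 2 : ℝ) * inner ℂ y (T y) +
        star ζ * inner ℂ y (T x) + ζ * inner ℂ x (T y) := by
  have h : ((‖ζ‖ ^ 2 : ℝ) : ℂ) = star ζ * ζ := by
    rw [← normSq_eq_norm_sq, normSq_eq_conj_mul_self]; rfl
  simp only [map_add, map_smul, inner_add_left, inner_add_right, inner_smul_left,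
    inner_smul_right, h, starRingEnd_apply]
  ring

/-- Weighted polarization: `⟨T x, y⟩` is bounded by means of the values of the quadratic form at
`x ± i y`, bounded by the numerical radius, and at `x - ζ y`, `x - ζ̄ y`, which lie in the sector
and enter with a favourable sign. -/
theorem re_inner_le_of_sector {α : ℝ} (hα0 : 0 < α) (hα1 : α ≤ Real.pi / 2) {T : H →L[ℂ] H}
    (hT : numericalRange T ⊆ sector α) (x y : H) :
    4 * (inner ℂ y (T x)).re ≤
      numericalRadius T * √(1 + Real.sin α ^ 2) * (2 * (‖x‖ ^ 2 + ‖y‖ ^ 2)) := by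
  have hσ : 0 < Real.sin α := Real.sin_pos_of_pos_of_lt_pi hα0 (by linarith [Real.pi_pos])
  have hσκ := Real.sin_sq_add_cos_sq α
  set σ := Real.sin α
  set κ := Real.cos α
  set p := √(1 + σ ^ 2 - (σ ^ 2) ^ 2) with hp
  have hs1 : σ ^ 2 ≤ 1 := by nlinarith
  have hpos : 0 < 1 + σ ^ 2 - (σ ^ 2) ^ 2 := by nlinarith [sq_nonneg σ]
  have hp0 : 0 < p := Real.sqrt_pos.2 hpos
  have hp2 : p ^ 2 = 1 + σ ^ 2 - (σ ^ 2) ^ 2 := Real.sq_sqrt hpos.le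
  set ζ : ℂ := ⟨1 / p, σ * κ / p⟩ with hζ
  have hζn : ‖ζ‖ ^ 2 = 1 := by
    rw [← normSq_eq_norm_sq, normSq_apply]
    simp only [hζ]
    field_simp
    rw [hp2]
    linear_combination σ ^ 2 * hσκ
  have hN : ∀ ε : ℝ, ε ^ 2 = 1 → ‖(⟨p, ε * σ ^ 2⟩ : ℂ)‖ = √(1 + σ ^ 2) := by
    intro ε hε
    rw [norm_eq_sqrt_sq_add_sq]
    congr 1
    simp only [mul_pow, hε, hp2]
    ring
  -- the two terms at `x ± i y`
  have hw : ∀ (ε : ℝ) (u : H), ε ^ 2 = 1 → ((⟨p, ε * σ ^ 2⟩ : ℂ) * inner ℂ u (T u)).re ≤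
      numericalRadius T * √(1 + σ ^ 2) * ‖u‖ ^ 2 := by
    intro ε u hε
    refine (re_le_norm _).trans ?_
    rw [norm_mul, hN ε hε]
    have := mul_le_mul_of_nonneg_left (norm_inner_map_le T u) (Real.sqrt_nonneg (1 + σ ^ 2))
    linarith
  have h1 := hw 1 (x + I • y) (by norm_num)
  have h2 := hw (-1) (x + (-I) • y) (by norm_num)
  have hpar : ‖x + I • y‖ ^ 2 + ‖x + (-I) • y‖ ^ 2 = 2 * (‖x‖ ^ 2 + ‖y‖ ^ 2) := by
    have := parallelogram_law_with_norm ℂ x (I • y)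
    rw [norm_smul, norm_I, one_mul] at this
    rw [neg_smul, ← sub_eq_add_neg]
    linarith
  -- the two terms in the sector
  have hsec : ∀ u : H, |(inner ℂ u (T u)).im| * κ ≤ (inner ℂ u (T u)).re * σ := fun u =>
    (inner_map_mem_sector hT u).2
  have hκ : 0 ≤ κ := Real.cos_nonneg_of_mem_Icc ⟨by linarith [Real.pi_pos], hα1⟩
  have h3 : 0 ≤ σ * (inner ℂ (x + (-ζ) • y) (T (x + (-ζ) • y))).re
      - κ * (inner ℂ (x + (-ζ) • y) (T (x + (-ζ) • y))).im := by
    have := hsec (x + (-ζ) • y)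
    have := mul_le_mul_of_nonneg_right (le_abs_self
      (inner ℂ (x + (-ζ) • y) (T (x + (-ζ) • y))).im) hκ
    linarith
  have h4 : 0 ≤ σ * (inner ℂ (x + (-star ζ) • y) (T (x + (-star ζ) • y))).re
      + κ * (inner ℂ (x + (-star ζ) • y) (T (x + (-star ζ) • y))).im := by
    have := hsec (x + (-star ζ) • y)
    have := mul_le_mul_of_nonneg_right (neg_abs_le
      (inner ℂ (x + (-star ζ) • y) (T (x + (-star ζ) • y))).im) hκ
    linarith
  have h34 := mul_nonneg (div_pos hp0 hσ).le (add_nonneg h3 h4)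
  -- the real part of the weighted polarization identity
  have key : ((⟨p, 1 * σ ^ 2⟩ : ℂ) * inner ℂ (x + I • y) (T (x + I • y))).re +
      ((⟨p, -1 * σ ^ 2⟩ : ℂ) * inner ℂ (x + (-I) • y) (T (x + (-I) • y))).re =
      4 * (inner ℂ y (T x)).re + p / σ *
        ((σ * (inner ℂ (x + (-ζ) • y) (T (x + (-ζ) • y))).re
          - κ * (inner ℂ (x + (-ζ) • y) (T (x + (-ζ) • y))).im) +
        (σ * (inner ℂ (x + (-star ζ) • y) (T (x + (-star ζ) • y))).re
          + κ * (inner ℂ (x + (-star ζ) • y) (T (x + (-star ζ) • y))).im)) := by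
    have hζ' : ‖star ζ‖ ^ 2 = 1 := by rw [norm_star]; exact hζn
    simp only [inner_add_smul_map, norm_neg, hζn, hζ', norm_I]
    simp only [hζ, mul_re, mul_im, add_re, add_im, neg_re, neg_im, star_def, conj_re, conj_im,
      I_re, I_im, ofReal_re, ofReal_im, map_neg]
    field_simp
    linear_combination (2 * (inner ℂ y (T x)).re - 2 * (inner ℂ x (T y)).re) * σ * hσκ
  rw [← hpar, mul_add]
  linarith

theorem opNorm_le_of_sector {α : ℝ} (hα0 : 0 < α) (hα1 : α ≤ Real.pi / 2) {T : H →L[ℂ] H}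
    (hT : numericalRange T ⊆ sector α) :
    ‖T‖ ≤ numericalRadius T * √(1 + Real.sin α ^ 2) := by
  refine T.opNorm_le_bound (mul_nonneg (numericalRadius_nonneg T) (Real.sqrt_nonneg _)) fun x => ?_
  set C := numericalRadius T * √(1 + Real.sin α ^ 2)
  rcases eq_or_ne (T x) 0 with h0 | h0
  · rw [h0, norm_zero]
    exact mul_nonneg (mul_nonneg (numericalRadius_nonneg T) (Real.sqrt_nonneg _)) (norm_nonneg x)
  have hx : 0 < ‖x‖ := norm_pos_iff.2 fun h => h0 (by simp [h])
  have hTx : 0 < ‖T x‖ := norm_pos_iff.2 h0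
  have h := re_inner_le_of_sector hα0 hα1 hT x (((‖x‖ / ‖T x‖ : ℝ) : ℂ) • T x)
  have hn : ‖((‖x‖ / ‖T x‖ : ℝ) : ℂ) • T x‖ = ‖x‖ := by
    rw [norm_smul, norm_real, Real.norm_of_nonneg (by positivity)]
    field_simp
  have hi : (inner ℂ (((‖x‖ / ‖T x‖ : ℝ) : ℂ) • T x) (T x)).re = ‖x‖ * ‖T x‖ := by
    rw [inner_smul_left, conj_ofReal, re_ofReal_mul]
    have : (inner ℂ (T x) (T x)).re = ‖T x‖ ^ 2 := inner_self_eq_norm_sq (𝕜 := ℂ) (T x)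
    rw [this]
    field_simp
  rw [hn, hi] at h
  refine le_of_mul_le_mul_left ?_ hx
  linarith

/-- A nonzero operator with `W(T) ⊆ S(α)` has positive numerical radius, so that the ratio
`‖T‖ / w(T)` is a genuine quotient. -/
theorem numericalRadius_pos_of_sector {α : ℝ} (hα0 : 0 < α) (hα1 : α ≤ Real.pi / 2)
    {T : H →L[ℂ] H} (hT : numericalRange T ⊆ sector α) (h0 : T ≠ 0) : 0 < numericalRadius T := by
  refine (numericalRadius_nonneg T).lt_of_ne fun h => h0 ?_
  have := opNorm_le_of_sector hα0 hα1 hT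
  rw [← h, zero_mul] at this
  exact norm_le_zero_iff.1 this

end

/-! ### The extremal matrix -/

/-- The quadratic form of the extremal matrix is an affine function of the coordinates
`|a|² - |b|²`, `2 Re (ā b)`, `2 Im (ā b)` of the vector `(a, b)`,
with constant term a multiple of `|a|² + |b|²`. -/
theorem inner_matOp_extremalMatrix (α : ℝ) (v : EuclideanSpace ℂ (Fin 2)) :
    inner ℂ v (matOp (extremalMatrix α) v) =
      (((1 + 2 * Real.sin α ^ 2)⁻¹ : ℝ) : ℂ) *
        (⟨√(1 + Real.sin α ^ 2 - (Real.sin α ^ 2) ^ 2) * ‖v‖ ^ 2 +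
            Real.sin α ^ 2 * (2 * (star (v 0) * v 1).re),
          √(Real.sin α ^ 2 + (Real.sin α ^ 2) ^ 2) * (normSq (v 0) - normSq (v 1)) +
            Real.sin α ^ 2 * (2 * (star (v 0) * v 1).im)⟩ : ℂ) := by
  rw [EuclideanSpace.norm_sq_eq, PiLp.inner_apply]
  simp only [matOp, Matrix.ofLp_toEuclideanCLM, extremalMatrix, Matrix.mulVec, dotProduct,
    Fin.sum_univ_two, ← normSq_eq_norm_sq]
  generalize √(1 + Real.sin α ^ 2 - (Real.sin α ^ 2) ^ 2) = p
  generalize √(Real.sin α ^ 2 + (Real.sin α ^ 2) ^ 2) = q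
  generalize (1 + 2 * Real.sin α ^ 2)⁻¹ = k
  generalize Real.sin α ^ 2 = s
  apply Complex.ext <;> simp [normSq_apply] <;> ring

/-- The coordinates `|a|² - |b|²`, `2 Re (ā b)`, `2 Im (ā b)` of a unit vector `(a, b)` lie on the
unit sphere of `ℝ³`. -/
theorem bloch_sq_add_sq (a b : ℂ) :
    (normSq a - normSq b) ^ 2 + (2 * (star a * b).re) ^ 2 + (2 * (star a * b).im) ^ 2 =
      (normSq a + normSq b) ^ 2 := by
  simp [normSq_apply]
  ring

theorem norm_sq_eq_normSq_add (v : EuclideanSpace ℂ (Fin 2)) :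
    ‖v‖ ^ 2 = normSq (v 0) + normSq (v 1) := by
  simp [EuclideanSpace.norm_sq_eq, normSq_eq_norm_sq]

theorem sq_dot_three_le (a b c x y z : ℝ) :
    (a * x + b * y + c * z) ^ 2 ≤ (a ^ 2 + b ^ 2 + c ^ 2) * (x ^ 2 + y ^ 2 + z ^ 2) := by
  nlinarith [sq_nonneg (a * y - b * x), sq_nonneg (a * z - c * x), sq_nonneg (b * z - c * y)]

theorem numericalRange_extremalMatrix_subset {α : ℝ} (hα0 : 0 < α) (hα1 : α ≤ Real.pi / 2) :
    numericalRange (matOp (extremalMatrix α)) ⊆ sector α := by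
  rintro _ ⟨v, hv, rfl⟩
  rw [inner_matOp_extremalMatrix]
  have hb := bloch_sq_add_sq (v 0) (v 1)
  rw [← norm_sq_eq_normSq_add, hv] at hb
  refine ofReal_mul_mem_sector (by positivity) ?_
  rw [hv]
  have hσ : 0 < Real.sin α := Real.sin_pos_of_pos_of_lt_pi hα0 (by linarith [Real.pi_pos])
  have hσκ := Real.sin_sq_add_cos_sq α
  have hs1 : Real.sin α ^ 2 ≤ 1 := Real.sin_sq_le_one α
  have hp2 : √(1 + Real.sin α ^ 2 - (Real.sin α ^ 2) ^ 2) ^ 2 =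
      1 + Real.sin α ^ 2 - (Real.sin α ^ 2) ^ 2 :=
    Real.sq_sqrt (by nlinarith [sq_nonneg (Real.sin α)])
  have hq2 : √(Real.sin α ^ 2 + (Real.sin α ^ 2) ^ 2) ^ 2 =
      Real.sin α ^ 2 + (Real.sin α ^ 2) ^ 2 := Real.sq_sqrt (by positivity)
  have hp0 := Real.sqrt_nonneg (1 + Real.sin α ^ 2 - (Real.sin α ^ 2) ^ 2)
  have hκ : 0 ≤ Real.cos α := Real.cos_nonneg_of_mem_Icc ⟨by linarith [Real.pi_pos], hα1⟩
  simp only [sector, Set.mem_ofPred_eq]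
  generalize √(1 + Real.sin α ^ 2 - (Real.sin α ^ 2) ^ 2) = p at *
  generalize √(Real.sin α ^ 2 + (Real.sin α ^ 2) ^ 2) = q at *
  generalize normSq (v 0) - normSq (v 1) = z at *
  generalize 2 * (star (v 0) * v 1).re = X at *
  generalize 2 * (star (v 0) * v 1).im = Y at *
  generalize Real.sin α = σ at *
  generalize Real.cos α = κ at *
  -- both supporting lines of the sector are handled by Cauchy–Schwarz
  have hcs : ∀ ε : ℝ, ε ^ 2 = 1 →
      ε * (q * z + σ ^ 2 * Y) * κ ≤ (p * 1 ^ 2 + σ ^ 2 * X) * σ := by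
    intro ε hε
    have h := sq_dot_three_le (ε * κ * q) (-σ ^ 3) (ε * κ * σ ^ 2) z X Y
    have hc : (ε * κ * q) ^ 2 + (-σ ^ 3) ^ 2 + (ε * κ * σ ^ 2) ^ 2 = (p * σ) ^ 2 := by
      linear_combination (κ ^ 2 * q ^ 2 + κ ^ 2 * σ ^ 4) * hε + κ ^ 2 * hq2 - σ ^ 2 * hp2 +
        (σ ^ 2 + 2 * σ ^ 4) * hσκ
    rw [hc, hb, one_pow, one_pow, mul_one] at h
    have := (abs_le_of_sq_le_sq' h (by positivity)).2
    linarith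
  have h1 := hcs 1 (by norm_num)
  have h2 := hcs (-1) (by norm_num)
  have him : |q * z + σ ^ 2 * Y| * κ ≤ (p * 1 ^ 2 + σ ^ 2 * X) * σ := by
    rcases abs_choice (q * z + σ ^ 2 * Y) with h | h <;> rw [h] <;> linarith
  refine ⟨?_, him⟩
  exact nonneg_of_mul_nonneg_left ((mul_nonneg (abs_nonneg _) hκ).trans him) hσ

theorem numericalRadius_extremalMatrix_le (α : ℝ) :
    numericalRadius (matOp (extremalMatrix α)) ≤ (√(1 + Real.sin α ^ 2))⁻¹ := by
  refine numericalRadius_le _ (by positivity) fun v => ?_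
  rw [inner_matOp_extremalMatrix]
  have hb := bloch_sq_add_sq (v 0) (v 1)
  rw [← norm_sq_eq_normSq_add] at hb
  have hp2 : √(1 + Real.sin α ^ 2 - (Real.sin α ^ 2) ^ 2) ^ 2 =
      1 + Real.sin α ^ 2 - (Real.sin α ^ 2) ^ 2 :=
    Real.sq_sqrt (by nlinarith [sq_nonneg (Real.sin α), Real.sin_sq_le_one α])
  have hq2 : √(Real.sin α ^ 2 + (Real.sin α ^ 2) ^ 2) ^ 2 =
      Real.sin α ^ 2 + (Real.sin α ^ 2) ^ 2 := Real.sq_sqrt (by positivity)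
  have hs0 : 0 ≤ Real.sin α ^ 2 := sq_nonneg _
  rw [norm_mul, norm_real, Real.norm_of_nonneg (by positivity), norm_eq_sqrt_sq_add_sq]
  generalize √(1 + Real.sin α ^ 2 - (Real.sin α ^ 2) ^ 2) = p at *
  generalize √(Real.sin α ^ 2 + (Real.sin α ^ 2) ^ 2) = q at *
  generalize normSq (v 0) - normSq (v 1) = z at *
  generalize 2 * (star (v 0) * v 1).re = X at *
  generalize 2 * (star (v 0) * v 1).im = Y at *
  generalize Real.sin α ^ 2 = s at *
  have hn : 0 ≤ ‖v‖ ^ 2 := sq_nonneg _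
  generalize ‖v‖ ^ 2 = n at *
  have hr : 0 < √(1 + s) := Real.sqrt_pos.2 (by positivity)
  have hr2 : √(1 + s) ^ 2 = 1 + s := Real.sq_sqrt (by positivity)
  rw [inv_mul_le_iff₀ (by positivity), ← mul_assoc, ← div_eq_mul_inv, div_mul_eq_mul_div,
    le_div_iff₀ hr]
  refine le_of_sq_le_sq ?_ (by positivity)
  rw [mul_pow, hr2, Real.sq_sqrt (by positivity)]
  have h1 : (q * z + s * Y) ^ 2 ≤ (s + 2 * s ^ 2) * (n ^ 2 - X ^ 2) := by
    have h := sq_dot_three_le q s 0 z Y 0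
    calc (q * z + s * Y) ^ 2 = (q * z + s * Y + 0 * 0) ^ 2 := by ring
      _ ≤ _ := h
      _ = _ := by
        linear_combination (z ^ 2 + Y ^ 2) * hq2 + (s + 2 * s ^ 2) * hb
  -- what remains is `s ((1 + s) X - p n) ^ 2 ≥ 0`
  have h2 : (1 + s) * ((p * n + s * X) ^ 2 + (s + 2 * s ^ 2) * (n ^ 2 - X ^ 2)) +
      s * ((1 + s) * X - p * n) ^ 2 = ((1 + 2 * s) * n) ^ 2 := by
    linear_combination ((1 + 2 * s) * n ^ 2) * hp2
  have h3 := mul_nonneg hs0 (sq_nonneg ((1 + s) * X - p * n))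
  have h4 := mul_le_mul_of_nonneg_left h1 (by positivity : 0 ≤ 1 + s)
  linarith

/-- The vector `(p - i q, 1 + 2 s)` is mapped to `(1 + 2 s, p - i q)`, which has the same norm. -/
theorem one_le_opNorm_extremalMatrix (α : ℝ) : 1 ≤ ‖matOp (extremalMatrix α)‖ := by
  have hs0 : 0 ≤ Real.sin α ^ 2 := sq_nonneg _
  have hp2 : √(1 + Real.sin α ^ 2 - (Real.sin α ^ 2) ^ 2) ^ 2 =
      1 + Real.sin α ^ 2 - (Real.sin α ^ 2) ^ 2 :=
    Real.sq_sqrt (by nlinarith [sq_nonneg (Real.sin α), Real.sin_sq_le_one α])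
  have hq2 : √(Real.sin α ^ 2 + (Real.sin α ^ 2) ^ 2) ^ 2 =
      Real.sin α ^ 2 + (Real.sin α ^ 2) ^ 2 := Real.sq_sqrt (by positivity)
  have hA : extremalMatrix α = (((1 + 2 * Real.sin α ^ 2)⁻¹ : ℝ) : ℂ) •
      !![(√(1 + Real.sin α ^ 2 - (Real.sin α ^ 2) ^ 2) : ℂ) +
          I * (√(Real.sin α ^ 2 + (Real.sin α ^ 2) ^ 2) : ℂ), ((2 * Real.sin α ^ 2 : ℝ) : ℂ);
        0, (√(1 + Real.sin α ^ 2 - (Real.sin α ^ 2) ^ 2) : ℂ) -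
          I * (√(Real.sin α ^ 2 + (Real.sin α ^ 2) ^ 2) : ℂ)] := rfl
  generalize √(1 + Real.sin α ^ 2 - (Real.sin α ^ 2) ^ 2) = p at *
  generalize √(Real.sin α ^ 2 + (Real.sin α ^ 2) ^ 2) = q at *
  generalize Real.sin α ^ 2 = s at *
  have h0 : (((1 + 2 * s : ℝ) : ℂ)) ≠ 0 := ofReal_ne_zero.2 (by positivity)
  have hpq : ((p : ℂ) + I * q) * (p - I * q) = ((1 + 2 * s : ℝ) : ℂ) := by
    have h : p ^ 2 + q ^ 2 = 1 + 2 * s := by linear_combination hp2 + hq2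
    rw [← h]
    push_cast
    linear_combination -(q : ℂ) ^ 2 * I_sq
  have hmap : matOp (extremalMatrix α) !₂[(p : ℂ) - I * q, ((1 + 2 * s : ℝ) : ℂ)] =
      !₂[((1 + 2 * s : ℝ) : ℂ), (p : ℂ) - I * q] := by
    rw [hA]
    generalize hc : ((1 + 2 * s : ℝ) : ℂ) = c at *
    have h2s : ((2 * s : ℝ) : ℂ) = c - 1 := by rw [← hc]; push_cast; ring
    ext i
    fin_cases i
    · simp only [matOp, Matrix.ofLp_toEuclideanCLM, ofReal_inv, hc, h2s]
      simp [Matrix.mulVec, dotProduct, Fin.sum_univ_two]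
      field_simp
      linear_combination hpq
    · simp only [matOp, Matrix.ofLp_toEuclideanCLM, ofReal_inv, hc, h2s]
      simp [Matrix.mulVec, dotProduct, Fin.sum_univ_two]
      field_simp
  have hnorm : ‖!₂[((1 + 2 * s : ℝ) : ℂ), (p : ℂ) - I * q]‖ =
      ‖!₂[(p : ℂ) - I * q, ((1 + 2 * s : ℝ) : ℂ)]‖ := by
    rw [EuclideanSpace.norm_eq, EuclideanSpace.norm_eq, Fin.sum_univ_two, Fin.sum_univ_two]
    congr 1
    exact add_comm _ _
  have hpos : 0 < ‖!₂[(p : ℂ) - I * q, ((1 + 2 * s : ℝ) : ℂ)]‖ := by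
    refine norm_pos_iff.2 fun h => h0 ?_
    simpa using congrArg (fun w : EuclideanSpace ℂ (Fin 2) => w 1) h
  have h := (matOp (extremalMatrix α)).le_opNorm !₂[(p : ℂ) - I * q, ((1 + 2 * s : ℝ) : ℂ)]
  rw [hmap, hnorm] at h
  exact le_of_mul_le_mul_right (by rwa [one_mul]) hpos

theorem extremalMatrix_ne_zero (α : ℝ) : extremalMatrix α ≠ 0 := by
  intro h
  have := one_le_opNorm_extremalMatrix α
  rw [h, matOp, map_zero, norm_zero] at this
  linarith

theorem opNorm_div_numericalRadius_extremalMatrix {α : ℝ} (hα0 : 0 < α)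
    (hα1 : α ≤ Real.pi / 2) :
    ‖matOp (extremalMatrix α)‖ / numericalRadius (matOp (extremalMatrix α)) =
      √(1 + Real.sin α ^ 2) := by
  have hsub := numericalRange_extremalMatrix_subset hα0 hα1
  have h1 := one_le_opNorm_extremalMatrix α
  have hw := numericalRadius_pos_of_sector hα0 hα1 hsub
    (norm_pos_iff.1 (zero_lt_one.trans_le h1))
  have hr : 0 < √(1 + Real.sin α ^ 2) := Real.sqrt_pos.2 (by positivity)
  refine le_antisymm ((div_le_iff₀' hw).2 (opNorm_le_of_sector hα0 hα1 hsub)) ?_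
  rw [le_div_iff₀ hw]
  refine le_trans ?_ h1
  calc _ ≤ √(1 + Real.sin α ^ 2) * (√(1 + Real.sin α ^ 2))⁻¹ := by
        gcongr
        exact numericalRadius_extremalMatrix_le α
    _ = 1 := mul_inv_cancel₀ hr.ne'

/-! ### Extension by zero -/

section

variable {H : Type*} [NormedAddCommGroup H] [InnerProductSpace ℂ H] [CompleteSpace H]
  (J : EuclideanSpace ℂ (Fin 2) →ₗᵢ[ℂ] H) (A : Matrix (Fin 2) (Fin 2) ℂ)

/-- The adjoint of `J` gives the coordinates in `ℂ²` of the projection to the range of `J`. -/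
theorem inner_sumZero (x : H) :
    inner ℂ x (sumZero J A x) =
      inner ℂ (ContinuousLinearMap.adjoint J.toContinuousLinearMap x)
        (matOp A (ContinuousLinearMap.adjoint J.toContinuousLinearMap x)) := by
  rw [ContinuousLinearMap.adjoint_inner_left]
  rfl

theorem inner_sumZero_isometry (v : EuclideanSpace ℂ (Fin 2)) :
    inner ℂ (J v) (sumZero J A (J v)) = inner ℂ v (matOp A v) := by
  rw [sumZero_apply_isometry, J.inner_map_map]

theorem norm_adjoint_isometry_le (x : H) :
    ‖ContinuousLinearMap.adjoint J.toContinuousLinearMap x‖ ≤ ‖x‖ := by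
  refine (ContinuousLinearMap.le_of_opNorm_le _ ?_ x).trans_eq (one_mul _)
  rw [LinearIsometryEquiv.norm_map]
  exact J.norm_toContinuousLinearMap_le

theorem numericalRange_sumZero_subset {α : ℝ} (hA : numericalRange (matOp A) ⊆ sector α) :
    numericalRange (sumZero J A) ⊆ sector α := by
  rintro _ ⟨x, -, rfl⟩
  rw [inner_sumZero]
  exact inner_map_mem_sector hA _

theorem numericalRadius_sumZero : numericalRadius (sumZero J A) = numericalRadius (matOp A) := by
  refine le_antisymm (numericalRadius_le _ (numericalRadius_nonneg _) fun x => ?_)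
    (numericalRadius_le _ (numericalRadius_nonneg _) fun v => ?_)
  · rw [inner_sumZero]
    refine (norm_inner_map_le _ _).trans ?_
    gcongr
    · exact numericalRadius_nonneg _
    · exact norm_adjoint_isometry_le J x
  · rw [← inner_sumZero_isometry J A, ← J.norm_map v]
    exact norm_inner_map_le _ _

theorem opNorm_sumZero : ‖sumZero J A‖ = ‖matOp A‖ := by
  refine le_antisymm (ContinuousLinearMap.opNorm_le_bound _ (norm_nonneg _) fun x => ?_)
    (ContinuousLinearMap.opNorm_le_bound _ (norm_nonneg _) fun v => ?_)
  · have h : ‖sumZero J A x‖ =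
        ‖matOp A (ContinuousLinearMap.adjoint J.toContinuousLinearMap x)‖ := J.norm_map _
    rw [h]
    refine ((matOp A).le_opNorm _).trans ?_
    gcongr
    exact norm_adjoint_isometry_le J x
  · have h := (sumZero J A).le_opNorm (J v)
    rwa [sumZero_apply_isometry, J.norm_map, J.norm_map] at h

theorem sumZero_ne_zero (hA : A ≠ 0) : sumZero J A ≠ 0 := by
  rw [← norm_ne_zero_iff, opNorm_sumZero, norm_ne_zero_iff]
  exact fun h => hA ((Matrix.toEuclideanCLM (n := Fin 2) (𝕜 := ℂ)).injective
    (h.trans (map_zero _).symm))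

end

theorem nonempty_linearIsometry_of_one_lt_rank {H : Type*} [NormedAddCommGroup H]
    [InnerProductSpace ℂ H] (h : 1 < Module.rank ℂ H) :
    Nonempty (EuclideanSpace ℂ (Fin 2) →ₗᵢ[ℂ] H) := by
  have h2 : ((2 : ℕ) : Cardinal) ≤ Module.rank ℂ H := by
    have := Order.succ_le_of_lt h
    rw [← Nat.cast_one, Cardinal.succ_natCast] at this
    exact_mod_cast this
  obtain ⟨v, hv⟩ := (Module.le_rank_iff (R := ℂ) (M := H) (n := 2)).1 h2
  have : FiniteDimensional ℂ (Submodule.span ℂ (Set.range v)) :=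
    FiniteDimensional.span_of_finite ℂ (Set.finite_range v)
  have hf : Module.finrank ℂ (Submodule.span ℂ (Set.range v)) = 2 := by
    rw [finrank_span_eq_card hv, Fintype.card_fin]
  exact ⟨(Submodule.span ℂ (Set.range v)).subtypeₗᵢ.comp
    ((stdOrthonormalBasis ℂ _).reindex (finCongr hf)).repr.symm.toLinearIsometry⟩

end SectorialOperator

theorem mainTheorem2 {H : Type*} [NormedAddCommGroup H] [InnerProductSpace ℂ H]
    [CompleteSpace H] (α : ℝ) (hα0 : 0 < α) (hα1 : α ≤ Real.pi / 2) :
    -- the inequality for an arbitrary operator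
    (∀ T : H →L[ℂ] H, numericalRange T ⊆ sector α →
      ‖T‖ ≤ numericalRadius T * Real.sqrt (1 + Real.sin α ^ 2)) ∧
    -- the explicit `2 × 2` matrix attains the bound
    (matOp (extremalMatrix α) ≠ 0 ∧
      numericalRange (matOp (extremalMatrix α)) ⊆ sector α ∧
      ‖matOp (extremalMatrix α)‖ / numericalRadius (matOp (extremalMatrix α)) =
        Real.sqrt (1 + Real.sin α ^ 2)) ∧
    -- for every `2 × 2` matrix `A` attaining the bound, so does every copy of `A ⊕ 0` on `H`
    (∀ A : Matrix (Fin 2) (Fin 2) ℂ, A ≠ 0 → numericalRange (matOp A) ⊆ sector α →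
      ‖matOp A‖ / numericalRadius (matOp A) = Real.sqrt (1 + Real.sin α ^ 2) →
      ∀ J : EuclideanSpace ℂ (Fin 2) →ₗᵢ[ℂ] H,
        sumZero J A ≠ 0 ∧
        numericalRange (sumZero J A) ⊆ sector α ∧
        ‖sumZero J A‖ / numericalRadius (sumZero J A) =
          Real.sqrt (1 + Real.sin α ^ 2)) ∧
    -- if `dim H > 1`, there are such copies, and the optimal ratio is attained and known
    (1 < Module.rank ℂ H →
      Nonempty (EuclideanSpace ℂ (Fin 2) →ₗᵢ[ℂ] H) ∧
      IsGreatest (ratioSet H α) (Real.sqrt (1 + Real.sin α ^ 2)) ∧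
      tau H α = Real.sqrt (1 + Real.sin α ^ 2)) := by

  have hsub := numericalRange_extremalMatrix_subset hα0 hα1
  have hratio := opNorm_div_numericalRadius_extremalMatrix hα0 hα1
  have hne := extremalMatrix_ne_zero α
  have hcopy : ∀ A : Matrix (Fin 2) (Fin 2) ℂ, A ≠ 0 → numericalRange (matOp A) ⊆ sector α →
      ‖matOp A‖ / numericalRadius (matOp A) = Real.sqrt (1 + Real.sin α ^ 2) →
      ∀ J : EuclideanSpace ℂ (Fin 2) →ₗᵢ[ℂ] H,
        sumZero J A ≠ 0 ∧
        numericalRange (sumZero J A) ⊆ sector α ∧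
        ‖sumZero J A‖ / numericalRadius (sumZero J A) =
          Real.sqrt (1 + Real.sin α ^ 2) := by
    intro A hA hAs hAr J
    refine ⟨sumZero_ne_zero J A hA, numericalRange_sumZero_subset J A hAs, ?_⟩
    rw [opNorm_sumZero, numericalRadius_sumZero, hAr]
  refine ⟨fun T hT => opNorm_le_of_sector hα0 hα1 hT, ⟨?_, hsub, hratio⟩, hcopy, fun hrank => ?_⟩
  · exact norm_pos_iff.1 (zero_lt_one.trans_le (one_le_opNorm_extremalMatrix α))
  · obtain ⟨J⟩ := nonempty_linearIsometry_of_one_lt_rank hrank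
    have hmax : IsGreatest (ratioSet H α) (Real.sqrt (1 + Real.sin α ^ 2)) := by
      obtain ⟨h0, hs, hr⟩ := hcopy _ hne hsub hratio J
      refine ⟨⟨_, h0, hs, hr.symm⟩, ?_⟩
      rintro _ ⟨T, hT0, hT, rfl⟩
      exact (div_le_iff₀' (numericalRadius_pos_of_sector hα0 hα1 hT hT0)).2
        (opNorm_le_of_sector hα0 hα1 hT)
    exact ⟨⟨J⟩, hmax, hmax.csSup_eq⟩
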